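/- Let $\gamma>0$ be fixed, let $A\in\mathbb{R}^{n\times n}$ be symmetric positive definite, $b\in\mathbb{R}^n$, $f(x)=\tfrac12x^TAx-b^Tx$ and $g_k=\nabla f(x_k)$. Let $x_1\in\mathbb{R}^n$ and $\alpha_1\ne 0$ be arbitrary, and consider the gradient method $x_{k+1}=x_k-\alpha_kg_k$ ($k\ge 1$) where, with $s_{k-1}=x_k-x_{k-1}$, $y_{k-1}=g_k-g_{k-1}$ and Euclidean norms, for every $k\ge2$ with $g_k\neq0$, \[ \alpha_k=\alpha^{BB}_k(\gamma)=\frac{\|s_{k-1}\|^2-\frac{\|y_{k-1}\|^2}{\gamma^2}+\sqrt{\left(\|s_{k-1}\|^2-\frac{\|y_{k-1}\|^2}{\gamma^2}\right)^2+\frac{4(s_{k-1}^Ty_{k-1})^2}{\gamma^2}}}{2\,s_{k-1}^Ty_{k-1}} \] (once $g_k=0$, the iteration stays at $x_k$). (i) For every $n$, either $\{\|g_k\|\}$ converges to zero R-linearly, i.e. there are $C$ and $r\in(0,1)$ with $\|g_k\|\le Cr^k$ for all $k$, or $g_k=0$ for some finite $k$. (ii) Let $n=2$, and suppose that $A$ has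 eigenvalues $\mu_1<\mu_2$ with unit eigenvectors $u_1,u_2$. Put $\lambda=\mu_2/\mu_1>1$, $g_k^{(i)}=u_i^Tg_k$, $M_k=\log\big(g_k^{(1)}/g_k^{(2)}\big)^2$, $\theta=\frac{1\pm\sqrt7\,i}{2}$ (either sign) and $\xi_2=M_2+(\theta-1)M_1$. (In the normalized case $A=\mathrm{diag}(1,\lambda)$, $b=0$, the numbers $g_k^{(1)},g_k^{(2)}$ are, up to sign, just the coordinates of $g_k$.) If $g_j^{(1)}\ne0$ and $g_j^{(2)}\neq0$ for $j=1,2$, and $|\xi_2|\ge 8\log\lambda$, then $\{\|g_k\|\}$ converges to zero R-superlinearly, i.e. $\|g_k\|^{1/k}\to0$. -/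

import Mathlib

open Filter Topology

noncomputable section

/-- The quadratic function `f(x) = (1/2) xᵀ A x - bᵀ x` on `ℝⁿ`. -/
def quadraticFun {n : ℕ} (A : Matrix (Fin n) (Fin n) ℝ) (b : EuclideanSpace ℝ (Fin n))
    (x : EuclideanSpace ℝ (Fin n)) : ℝ :=
  (1 / 2) * (x.ofLp ⬝ᵥ A.mulVec x.ofLp) - b.ofLp ⬝ᵥ x.ofLp

/-- The steplength obtained from scaled total least squares with parameter `γ`, as a function of
`s = s_{k-1}` and `y = y_{k-1}`. -/
def bbSteplength {n : ℕ} (γ : ℝ) (s y : EuclideanSpace ℝ (Fin n)) : ℝ :=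
  (‖s‖ ^ 2 - ‖y‖ ^ 2 / γ ^ 2 +
      Real.sqrt ((‖s‖ ^ 2 - ‖y‖ ^ 2 / γ ^ 2) ^ 2 + 4 * (inner ℝ s y) ^ 2 / γ ^ 2)) /
    (2 * inner ℝ s y)

/-- `x 1, x 2, …` are iterates, with steplengths `α 1, α 2, …`, of the gradient method
`x_{k+1} = x_k - α_k ∇f(x_k)` in which the first steplength is any nonzero number and every later
one is `bbSteplength γ s_{k-1} y_{k-1}` as long as the gradient has not vanished.
Once `∇f(x_k) = 0` the iteration stays at `x_k`. The values at index `0` play no role. -/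
structure IsBBRun {n : ℕ} (f : EuclideanSpace ℝ (Fin n) → ℝ) (γ : ℝ)
    (x : ℕ → EuclideanSpace ℝ (Fin n)) (α : ℕ → ℝ) : Prop where
  first : α 1 ≠ 0
  step : ∀ k, 1 ≤ k → x (k + 1) = x k - α k • gradient f (x k)
  steplength : ∀ k, 2 ≤ k → gradient f (x k) ≠ 0 →
    α k = bbSteplength γ (x k - x (k - 1)) (gradient f (x k) - gradient f (x (k - 1)))

/-- The nonnegative sequence `u` converges to zero (at least) R-linearly. -/
def ConvergesRLinearly (u : ℕ → ℝ) : Prop :=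
  ∃ C r : ℝ, 0 < r ∧ r < 1 ∧ ∀ k, u k ≤ C * r ^ k

/-- The nonnegative sequence `u` converges to zero R-superlinearly: `u_k ^ (1/k) → 0`. -/
def ConvergesRSuperlinearly (u : ℕ → ℝ) : Prop :=
  Tendsto (fun k : ℕ => u k ^ (1 / (k : ℝ))) atTop (𝓝 0)

/-- `M = log q` with `q = (⟨u₁, g⟩ / ⟨u₂, g⟩)²`, the logarithm of the squared ratio of the
components of `g` along `u₁` and `u₂`. -/
def logRatio {n : ℕ} (u₁ u₂ g : EuclideanSpace ℝ (Fin n)) : ℝ :=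
  Real.log ((inner ℝ u₁ g / inner ℝ u₂ g) ^ 2)

end

/-! ### Sequences with geometric bounds -/

/-! Since `s` and `y` are multiples of `g` and `A g`, the steplength is the positive root of a
quadratic which, in an eigenbasis, splits into the secular equation `∑ wᵢ (lᵢ α - 1)(α + lᵢ / γ²) =
0`. Here `wᵢ` are the squared components of the previous gradient, and each step multiplies
component `i` by `1 - α lᵢ`.

R-linear convergence (`convergesRLinearly_of_secular`): the equation forces `1 / α` to lie between
the extreme eigenvalues. If `lᵢ α ≤ 3/2`, component `i` contracts by a fixed factor; otherwise its
weight one step earlier is at most twice the total weight on smaller eigenvalues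
(`le_two_mul_sum_of_secular`). Induction from the smallest eigenvalue upwards concludes.

R-superlinear convergence (`exists_le_mul_pow_of_secular_two`): with two eigenvalues the equation
becomes `M (k+2) = M (k+1) - 2 M k + e k` with `|e k| ≤ 2 log λ`. The characteristic roots have
modulus `√2`, so a large enough initial `ξ` makes `ξ` diverge, and `M` takes arbitrarily large
positive and negative values in every late window of five indices. A large positive `M` makes the
first component contract by about `exp (-M)`, a large negative one the second, while one-step growth
stays bounded. Hence both components eventually lie below every geometric rate. -/

theorem convergesRLinearly_of_forall_ge {u : ℕ → ℝ} {C r : ℝ} (k₀ : ℕ) (hr : 0 < r) (hr1 : r < 1)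
    (h : ∀ k, k₀ ≤ k → u k ≤ C * r ^ k) : ConvergesRLinearly u := by
  refine ⟨|C| + ∑ j ∈ Finset.range k₀, |u j| / r ^ j, r, hr, hr1, fun k => ?_⟩
  have hp : 0 < r ^ k := pow_pos hr k
  have hnn : ∀ j ∈ Finset.range k₀, 0 ≤ |u j| / r ^ j := fun j _ => by positivity
  by_cases hk : k₀ ≤ k
  · refine (h k hk).trans (mul_le_mul_of_nonneg_right ?_ hp.le)
    linarith [le_abs_self C, Finset.sum_nonneg hnn]
  · have h1 := Finset.single_le_sum hnn (Finset.mem_range.2 (not_le.1 hk))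
    calc u k ≤ |u k| := le_abs_self _
      _ = |u k| / r ^ k * r ^ k := by field_simp
      _ ≤ _ := mul_le_mul_of_nonneg_right (by linarith [abs_nonneg C]) hp.le

theorem ConvergesRLinearly.const_mul {u : ℕ → ℝ} (hu : ConvergesRLinearly u) {D : ℝ}
    (hD : 0 ≤ D) : ConvergesRLinearly fun k => D * u k := by
  obtain ⟨C, r, h0, h1, h⟩ := hu
  exact ⟨D * C, r, h0, h1, fun k => by
    rw [mul_assoc]; exact mul_le_mul_of_nonneg_left (h k) hD⟩

theorem ConvergesRLinearly.add {u v : ℕ → ℝ} (hu : ConvergesRLinearly u)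
    (hv : ConvergesRLinearly v) : ConvergesRLinearly fun k => u k + v k := by
  obtain ⟨C, r, h0, h1, h⟩ := hu
  obtain ⟨C', r', h0', h1', h'⟩ := hv
  refine ⟨|C| + |C'|, max r r', lt_max_of_lt_left h0, max_lt h1 h1', fun k => ?_⟩
  have a1 : r ^ k ≤ max r r' ^ k := pow_le_pow_left₀ h0.le (le_max_left _ _) k
  have a2 : r' ^ k ≤ max r r' ^ k := pow_le_pow_left₀ h0'.le (le_max_right _ _) k
  calc u k + v k ≤ |C| * r ^ k + |C'| * r' ^ k := by
        have := mul_le_mul_of_nonneg_right (le_abs_self C) (pow_nonneg h0.le k)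
        have := mul_le_mul_of_nonneg_right (le_abs_self C') (pow_nonneg h0'.le k)
        linarith [h k, h' k]
    _ ≤ |C| * max r r' ^ k + |C'| * max r r' ^ k := by gcongr
    _ = _ := by ring

theorem ConvergesRLinearly.sum {ι : Type*} (s : Finset ι) {u : ι → ℕ → ℝ}
    (h : ∀ i ∈ s, ConvergesRLinearly (u i)) : ConvergesRLinearly fun k => ∑ i ∈ s, u i k := by
  classical
  induction s using Finset.induction_on with
  | empty => exact ⟨0, 1 / 2, by norm_num, by norm_num, fun k => by simp⟩
  | insert a s ha ih =>
    simp only [Finset.sum_insert ha]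
    exact (h a (Finset.mem_insert_self a s)).add
      (ih fun i hi => h i (Finset.mem_insert_of_mem hi))

/-- A sequence that at each step contracts by a fixed factor or is dominated by an R-linearly
convergent sequence is R-linearly convergent. -/
theorem ConvergesRLinearly.of_contract_or_le {u h : ℕ → ℝ} {ρ : ℝ} (hu : ConvergesRLinearly u)
    (hρ : 0 < ρ) (hρ1 : ρ < 1) (k₀ : ℕ)
    (hstep : ∀ k, k₀ ≤ k → h (k + 1) ≤ ρ * h k ∨ h (k + 1) ≤ u k) : ConvergesRLinearly h := by
  obtain ⟨C, r, h0, h1, hC⟩ := hu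
  set R := max r ρ with hR
  have hR0 : 0 < R := lt_max_of_lt_left h0
  -- The second entry settles the base case; the first absorbs `C * r ^ k` into `D * R ^ (k + 1)`.
  set D := max (|C| / R) (|h k₀| / R ^ k₀) with hD
  have hD0 : 0 ≤ D := le_max_of_le_left (by positivity)
  refine convergesRLinearly_of_forall_ge (C := D) k₀ hR0 (max_lt h1 hρ1) fun k hk => ?_
  induction k, hk using Nat.le_induction with
  | base =>
    calc h k₀ ≤ |h k₀| := le_abs_self _
      _ = |h k₀| / R ^ k₀ * R ^ k₀ := by field_simp
      _ ≤ _ := by gcongr; exact le_max_right _ _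
  | succ k hk ih =>
    rcases hstep k hk with h2 | h2
    · calc h (k + 1) ≤ ρ * h k := h2
        _ ≤ R * (D * R ^ k) := by
          refine (mul_le_mul_of_nonneg_left ih hρ.le).trans ?_
          gcongr; exact le_max_right _ _
        _ = _ := by ring
    · calc h (k + 1) ≤ C * r ^ k := h2.trans (hC k)
        _ ≤ |C| * R ^ k := by gcongr; exacts [le_abs_self C, le_max_left _ _]
        _ = |C| / R * R ^ (k + 1) := by rw [pow_succ]; field_simp
        _ ≤ _ := by gcongr; exact le_max_left _ _

theorem ConvergesRLinearly.of_succ {u : ℕ → ℝ} (h : ConvergesRLinearly fun k => u (k + 1)) :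
    ConvergesRLinearly u := by
  obtain ⟨C, r, h0, h1, h⟩ := h
  refine convergesRLinearly_of_forall_ge (C := C / r) 1 h0 h1 fun k hk => ?_
  obtain ⟨j, rfl⟩ : ∃ j, k = j + 1 := ⟨k - 1, by omega⟩
  refine (h j).trans_eq ?_
  rw [pow_succ]
  field_simp

theorem ConvergesRLinearly.of_sq {u : ℕ → ℝ} (h : ConvergesRLinearly fun k => u k ^ 2) :
    ConvergesRLinearly u := by
  obtain ⟨C, r, h0, h1, h⟩ := h
  refine ⟨√C, √r, Real.sqrt_pos.2 h0, (Real.sqrt_lt' one_pos).2 (by simpa using h1), fun k => ?_⟩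
  have hC : 0 ≤ C := by simpa using (sq_nonneg _).trans (h 0)
  refine le_of_abs_le (abs_le_of_sq_le_sq' ?_ (by positivity) |> abs_le.2)
  rw [mul_pow, Real.sq_sqrt hC, ← pow_mul, mul_comm k, pow_mul, Real.sq_sqrt h0.le]
  exact h k

/-- A sequence contracting by arbitrarily small factors over windows of fixed length is bounded by
every geometric sequence. -/
theorem exists_le_mul_pow_of_eventually_le {u : ℕ → ℝ} {m : ℕ} (hm : 0 < m)
    (h : ∀ ε : ℝ, 0 < ε → ∀ᶠ k in atTop, u (k + m) ≤ ε * u k) {r : ℝ} (hr : 0 < r) :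
    ∃ C, ∀ k, u k ≤ C * r ^ k := by
  obtain ⟨k₀, hk₀⟩ := eventually_atTop.1 (h (r ^ m) (pow_pos hr m))
  have hnn : ∀ j ∈ Finset.range (k₀ + m), 0 ≤ |u j| / r ^ j := fun j _ => by positivity
  -- This constant covers every index below `k₀ + m`; beyond it, one window of length `m` gains
  -- exactly `r ^ m`.
  refine ⟨∑ j ∈ Finset.range (k₀ + m), |u j| / r ^ j, fun k => ?_⟩
  induction k using Nat.strong_induction_on with
  | _ k ih =>
    by_cases hk : k < k₀ + m
    · calc u k ≤ |u k| := le_abs_self _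
        _ = |u k| / r ^ k * r ^ k := by field_simp
        _ ≤ _ := by
          gcongr
          exact Finset.single_le_sum hnn (Finset.mem_range.2 hk)
    · obtain ⟨j, rfl⟩ : ∃ j, k = j + m := ⟨k - m, by omega⟩
      calc u (j + m) ≤ r ^ m * u j := hk₀ j (by omega)
        _ ≤ r ^ m * (_ * r ^ j) := mul_le_mul_of_nonneg_left (ih j (by omega)) (by positivity)
        _ = _ := by rw [pow_add]; ring

theorem convergesRSuperlinearly_of_forall_le {u : ℕ → ℝ} (hu : ∀ k, 0 ≤ u k)
    (h : ∀ r : ℝ, 0 < r → ∃ C, ∀ k, 1 ≤ k → u k ≤ C * r ^ k) : ConvergesRSuperlinearly u := by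
  refine tendsto_order.2 ⟨fun a ha => Eventually.of_forall fun k =>
    ha.trans_le (Real.rpow_nonneg (hu k) _), fun a ha => ?_⟩
  -- The `k`-th root of the bound tends to `a / 2 < a`; `|C| + 1` keeps the constant positive, so
  -- that its `k`-th root tends to 1.
  obtain ⟨C, hC⟩ := h (a / 2) (by positivity)
  have hD : 0 < |C| + 1 := by positivity
  have hlim : Tendsto (fun k : ℕ => (|C| + 1) ^ (1 / (k : ℝ)) * (a / 2)) atTop
      (𝓝 ((|C| + 1) ^ (0 : ℝ) * (a / 2))) :=
    ((Real.continuousAt_const_rpow hD.ne').tendsto.comp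
      tendsto_one_div_atTop_nhds_zero_nat).mul_const _
  rw [Real.rpow_zero, one_mul] at hlim
  filter_upwards [hlim.eventually_lt_const (half_lt_self ha), eventually_gt_atTop 0] with k hk hk0
  refine lt_of_le_of_lt ?_ hk
  have hk' : (k : ℝ) ≠ 0 := by positivity
  calc u k ^ (1 / (k : ℝ)) ≤ ((|C| + 1) * (a / 2) ^ k) ^ (1 / (k : ℝ)) := by
        refine Real.rpow_le_rpow (hu k) ((hC k hk0).trans ?_) (by positivity)
        gcongr
        linarith [le_abs_self C]
    _ = _ := by
        rw [Real.mul_rpow hD.le (by positivity), ← Real.rpow_natCast (a / 2) k,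
          ← Real.rpow_mul (by positivity), mul_one_div_cancel hk', Real.rpow_one]

/-! ### The perturbed recurrence `M (k+2) = M (k+1) - 2 M k + e k` -/

/-- As `θ` is a root of `z² - z + 2`, the combination `ξ` obeys `ξ' = θ ξ + e`. The threshold `4 E`
exceeds `E / (√2 - 1)`, above which the expansion by `√2` beats the perturbation. -/
theorem tendsto_norm_add_mul_atTop {M e : ℕ → ℝ} {E : ℝ} {θ : ℂ} (hE : 0 < E)
    (hrec : ∀ k, M (k + 2) = M (k + 1) - 2 * M k + e k) (he : ∀ k, |e k| ≤ E)
    (hθ : θ ^ 2 = θ - 2) (hnorm : ‖θ‖ = √2) (h0 : 4 * E ≤ ‖(M 1 : ℂ) + (θ - 1) * (M 0 : ℂ)‖) :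
    Tendsto (fun k => ‖(M (k + 1) : ℂ) + (θ - 1) * (M k : ℂ)‖) atTop atTop := by
  have h2 : (1.4 : ℝ) ≤ √2 := Real.le_sqrt_of_sq_le (by norm_num)
  have key : ∀ k, E * 1.4 ^ k + 3 * E ≤ ‖(M (k + 1) : ℂ) + (θ - 1) * (M k : ℂ)‖ := by
    intro k
    induction k with
    | zero => simpa using (by linarith : E + 3 * E ≤ _)
    | succ k ih =>
      have e1 : (M (k + 1 + 1) : ℂ) + (θ - 1) * (M (k + 1) : ℂ)
          = θ * ((M (k + 1) : ℂ) + (θ - 1) * (M k : ℂ)) + (e k : ℂ) := by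
        rw [show k + 1 + 1 = k + 2 from rfl, hrec]
        push_cast
        linear_combination -(M k : ℂ) * hθ
      rw [e1]
      have a1 := norm_sub_le_norm_add (θ * ((M (k + 1) : ℂ) + (θ - 1) * (M k : ℂ))) (e k : ℂ)
      rw [norm_mul, hnorm, Complex.norm_real, Real.norm_eq_abs] at a1
      have a2 := mul_le_mul h2 ih (by positivity) (by positivity)
      have := he k
      rw [pow_succ]
      linarith
  refine tendsto_atTop_mono (fun k => le_trans ?_ (key k))
    ((tendsto_pow_atTop_atTop_of_one_lt (by norm_num : (1 : ℝ) < 1.4)).const_mul_atTop hE)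
  linarith

/-- Up to perturbations, `M (k+3) = -M (k+1) - 2 M k` and `M (k+4) = 2 M k - 3 M (k+1)`. If the
whole window lay below `B`, adding these would bound `M (k+1)` from below, and then `M k` as well,
so `ξ` would be bounded by a multiple of `|B| + E`. -/
theorem exists_window_ge {M e : ℕ → ℝ} {E : ℝ} {θ : ℂ}
    (hrec : ∀ k, M (k + 2) = M (k + 1) - 2 * M k + e k) (he : ∀ k, |e k| ≤ E)
    (hnorm : ‖θ‖ = √2)
    (hlim : Tendsto (fun k => ‖(M (k + 1) : ℂ) + (θ - 1) * (M k : ℂ)‖) atTop atTop) (B : ℝ) :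
    ∀ᶠ k in atTop, ∃ j < 5, B ≤ M (k + j) := by
  filter_upwards [hlim.eventually_gt_atTop (100 * (|B| + E))] with k hk
  by_contra! hcon
  have h0 := hcon 0 (by norm_num)
  have h1 := hcon 1 (by norm_num)
  have h3 := hcon 3 (by norm_num)
  have h4 := hcon 4 (by norm_num)
  have r0 := hrec k
  have r1 := hrec (k + 1)
  have r2 := hrec (k + 2)
  have e0 := abs_le.1 (he k)
  have e1 := abs_le.1 (he (k + 1))
  have e2 := abs_le.1 (he (k + 2))
  simp only [add_zero, add_assoc, Nat.reduceAdd] at *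
  have hB := le_abs_self B
  have hB' := neg_le_abs B
  have hE : 0 ≤ E := (abs_nonneg _).trans (he k)
  have a0 : |M k| ≤ 10 * (|B| + E) := abs_le.2 ⟨by linarith, by linarith⟩
  have a1 : |M (k + 1)| ≤ 20 * (|B| + E) := abs_le.2 ⟨by linarith, by linarith⟩
  have hs : √2 ≤ 2 := Real.sqrt_le_iff.2 (by norm_num)
  have hθ1 : ‖θ - 1‖ ≤ 3 := by
    have := norm_sub_le θ 1
    rw [norm_one, hnorm] at this
    linarith
  have := norm_add_le (M (k + 1) : ℂ) ((θ - 1) * (M k : ℂ))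
  rw [norm_mul, Complex.norm_real, Complex.norm_real, Real.norm_eq_abs, Real.norm_eq_abs] at this
  have := mul_le_mul hθ1 a0 (abs_nonneg _) (by norm_num)
  have := abs_nonneg B
  linarith

theorem exists_window_le {M e : ℕ → ℝ} {E : ℝ} {θ : ℂ}
    (hrec : ∀ k, M (k + 2) = M (k + 1) - 2 * M k + e k) (he : ∀ k, |e k| ≤ E)
    (hnorm : ‖θ‖ = √2)
    (hlim : Tendsto (fun k => ‖(M (k + 1) : ℂ) + (θ - 1) * (M k : ℂ)‖) atTop atTop) (B : ℝ) :
    ∀ᶠ k in atTop, ∃ j < 5, M (k + j) ≤ -B := by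
  have := exists_window_ge (M := fun k => -M k) (e := fun k => -e k) (E := E) (θ := θ)
    (fun k => by rw [hrec]; ring) (fun k => by rw [abs_neg]; exact he k) hnorm
    (hlim.congr fun k => by rw [← norm_neg]; congr 1; push_cast; ring) B
  filter_upwards [this] with k ⟨j, hj, hjB⟩
  exact ⟨j, hj, by linarith⟩

/-- If `u` grows by at most a fixed factor per step, and in every late window of length five some
step contracts by `exp (-N j)` with `N j` as large as wanted, then `u` contracts arbitrarily over
windows of length six. -/
theorem eventually_le_of_window {u N : ℕ → ℝ} {K : ℝ} (hu : ∀ k, 0 ≤ u k) (hK : 1 ≤ K)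
    (hgrow : ∀ k, 1 ≤ k → u (k + 1) ≤ K * u k)
    (hcontr : ∀ k, u (k + 2) ≤ K * Real.exp (-N k) * u (k + 1))
    (hN : ∀ B : ℝ, ∀ᶠ k in atTop, ∃ j < 5, B ≤ N (k + j)) {ε : ℝ} (hε : 0 < ε) :
    ∀ᶠ k in atTop, u (k + 6) ≤ ε * u k := by
  have hiter : ∀ a n, 1 ≤ a → u (a + n) ≤ K ^ n * u a := by
    intro a n ha
    induction n with
    | zero => simp
    | succ n ih =>
      calc u (a + n + 1) ≤ K * u (a + n) := hgrow _ (by omega)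
        _ ≤ K * (K ^ n * u a) := by gcongr
        _ = _ := by ring
  filter_upwards [hN (-Real.log (ε / K ^ 6)), eventually_ge_atTop 1] with k ⟨j, hj, hB⟩ hk
  have hexp : Real.exp (-N (k + j)) ≤ ε / K ^ 6 := by
    rw [← Real.exp_log (show 0 < ε / K ^ 6 by positivity)]
    exact Real.exp_le_exp.2 (by linarith)
  -- The contracting step goes from `k + j + 1` to `k + j + 2`. With `j + 1` growth steps before it
  -- and `4 - j` after, the factor `K` occurs six times.
  have h1 := hiter k (j + 1) hk
  have h2 := hcontr (k + j)
  have h3 := hiter (k + j + 2) (4 - j) (by omega)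
  rw [show k + j + 2 + (4 - j) = k + 6 by omega] at h3
  calc u (k + 6) ≤ K ^ (4 - j) * (K * Real.exp (-N (k + j)) * (K ^ (j + 1) * u k)) := by
        refine h3.trans (mul_le_mul_of_nonneg_left (h2.trans ?_) (by positivity))
        exact mul_le_mul_of_nonneg_left h1 (by positivity)
    _ = K ^ (4 - j + 1 + (j + 1)) * Real.exp (-N (k + j)) * u k := by
        rw [pow_add, pow_add]; ring
    _ = K ^ 6 * Real.exp (-N (k + j)) * u k := by
        rw [show 4 - j + 1 + (j + 1) = 6 by omega]
    _ ≤ K ^ 6 * (ε / K ^ 6) * u k := by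
        gcongr
        exact hu k
    _ = ε * u k := by field_simp

/-! ### Gradients of quadratic functions in spectral coordinates -/

section Quadratic

variable {n : ℕ} {A : Matrix (Fin n) (Fin n) ℝ}

theorem quadraticFun_eq_inner (A : Matrix (Fin n) (Fin n) ℝ) (b x : EuclideanSpace ℝ (Fin n)) :
    quadraticFun A b x = (1 / 2) * inner ℝ x (Matrix.toEuclideanCLM (𝕜 := ℝ) A x) - inner ℝ b x := by
  simp [quadraticFun, EuclideanSpace.inner_eq_star_dotProduct, Matrix.ofLp_toEuclideanCLM,
    dotProduct_comm]

theorem inner_toEuclideanCLM_comm (hA : A.IsHermitian) (x y : EuclideanSpace ℝ (Fin n)) :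
    inner ℝ (Matrix.toEuclideanCLM (𝕜 := ℝ) A x) y = inner ℝ x (Matrix.toEuclideanCLM (𝕜 := ℝ) A y) :=
  Matrix.isSymmetric_toEuclideanLin_iff.2 hA x y

theorem gradient_quadraticFun (hA : A.IsHermitian) (b x : EuclideanSpace ℝ (Fin n)) :
    gradient (quadraticFun A b) x = Matrix.toEuclideanCLM (𝕜 := ℝ) A x - b := by
  refine HasGradientAt.gradient ?_
  rw [hasGradientAt_iff_hasFDerivAt, funext (quadraticFun_eq_inner A b)]
  have h1 := ((hasFDerivAt_id (𝕜 := ℝ) x).inner ℝ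
    (Matrix.toEuclideanCLM (𝕜 := ℝ) A).hasFDerivAt).const_mul (1 / 2)
  have h2 := (hasFDerivAt_const b x).inner ℝ (hasFDerivAt_id (𝕜 := ℝ) x)
  refine (h1.sub h2).congr_fderiv ?_
  ext y
  simp [inner_toEuclideanCLM_comm hA, real_inner_comm y]
  rw [← inner_toEuclideanCLM_comm hA, real_inner_comm]
  ring

theorem inner_toEuclideanCLM_of_mulVec_eq (hA : A.IsHermitian) {v : EuclideanSpace ℝ (Fin n)}
    {l : ℝ} (hv : A.mulVec v.ofLp = l • v.ofLp) (x : EuclideanSpace ℝ (Fin n)) :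
    inner ℝ v (Matrix.toEuclideanCLM (𝕜 := ℝ) A x) = l * inner ℝ v x := by
  have : Matrix.toEuclideanCLM (𝕜 := ℝ) A v = l • v := by
    apply WithLp.ofLp_injective
    rw [Matrix.ofLp_toEuclideanCLM, hv, WithLp.ofLp_smul]
  rw [← inner_toEuclideanCLM_comm hA, this, real_inner_smul_left]

theorem gradient_quadraticFun_sub_smul (hA : A.IsHermitian) (b x d : EuclideanSpace ℝ (Fin n))
    (a : ℝ) : gradient (quadraticFun A b) (x - a • d)
      = gradient (quadraticFun A b) x - a • Matrix.toEuclideanCLM (𝕜 := ℝ) A d := by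
  simp only [gradient_quadraticFun hA, map_sub, map_smul]
  abel

end Quadratic

/-! ### The secular equation for the steplength -/

/-- The product of the roots is `-1 / γ ^ 2`; the root with the plus sign is the positive one
because the square root exceeds `|D|`. -/
theorem tls_root_spec {γ p D : ℝ} (hγ : 0 < γ) (hp : 0 < p) :
    let α := (D + √(D ^ 2 + 4 * p ^ 2 / γ ^ 2)) / (2 * p)
    0 < α ∧ p * α ^ 2 - D * α - p / γ ^ 2 = 0 := by
  intro α
  have hS : 0 < 4 * p ^ 2 / γ ^ 2 := by positivity
  have hlt : |D| < √(D ^ 2 + 4 * p ^ 2 / γ ^ 2) :=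
    Real.lt_sqrt_of_sq_lt (by rw [sq_abs]; linarith)
  have hsq := Real.sq_sqrt (by positivity : 0 ≤ D ^ 2 + 4 * p ^ 2 / γ ^ 2)
  have hα : 2 * p * α = D + √(D ^ 2 + 4 * p ^ 2 / γ ^ 2) := by
    simp only [α]; field_simp
  refine ⟨div_pos (by linarith [neg_abs_le D]) (by linarith), ?_⟩
  have h3 : (2 * p * α - D) ^ 2 = D ^ 2 + 4 * p ^ 2 / γ ^ 2 := by rw [hα]; linarith
  have h4 : 4 * p * (p * α ^ 2 - D * α - p / γ ^ 2) = 0 := by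
    linear_combination h3
  exact (mul_eq_zero.1 h4).resolve_left (by positivity)

/-- Parseval turns the three coefficients of the quadratic into sums over the eigenbasis with common
factor `t ^ 2`; the polynomial attached to each eigenvalue then factors. -/
theorem bbSteplength_spec {n : ℕ} {ι : Type*} [Fintype ι] {A : Matrix (Fin n) (Fin n) ℝ}
    (hA : A.IsHermitian) (v : OrthonormalBasis ι ℝ (EuclideanSpace ℝ (Fin n))) {l : ι → ℝ}
    (hv : ∀ i, A.mulVec (v i).ofLp = l i • (v i).ofLp) (hl : ∀ i, 0 < l i) {γ : ℝ} (hγ : 0 < γ)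
    {t : ℝ} (ht : t ≠ 0) {g : EuclideanSpace ℝ (Fin n)} (hg : g ≠ 0) {α : ℝ}
    (hα : α = bbSteplength γ (t • g) (t • Matrix.toEuclideanCLM (𝕜 := ℝ) A g)) :
    0 < α ∧ ∑ i, inner ℝ (v i) g ^ 2 * ((l i * α - 1) * (α + l i / γ ^ 2)) = 0 := by
  have hs : ‖t • g‖ ^ 2 = t ^ 2 * ∑ i, inner ℝ (v i) g ^ 2 := by
    rw [norm_smul, mul_pow, Real.norm_eq_abs, sq_abs, v.sum_sq_inner_right]
  have hy : ‖t • Matrix.toEuclideanCLM (𝕜 := ℝ) A g‖ ^ 2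
      = t ^ 2 * ∑ i, l i ^ 2 * inner ℝ (v i) g ^ 2 := by
    rw [norm_smul, mul_pow, Real.norm_eq_abs, sq_abs, ← v.sum_sq_inner_right]
    simp only [inner_toEuclideanCLM_of_mulVec_eq hA (hv _), mul_pow]
  have hp : inner ℝ (t • g) (t • Matrix.toEuclideanCLM (𝕜 := ℝ) A g)
      = t ^ 2 * ∑ i, l i * inner ℝ (v i) g ^ 2 := by
    rw [real_inner_smul_left, real_inner_smul_right, ← v.sum_inner_mul_inner]
    simp only [inner_toEuclideanCLM_of_mulVec_eq hA (hv _), real_inner_comm (v _) g]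
    rw [← mul_assoc, ← sq]
    congr 1
    exact Finset.sum_congr rfl fun i _ => by rw [real_inner_comm]; ring
  have hppos : 0 < inner ℝ (t • g) (t • Matrix.toEuclideanCLM (𝕜 := ℝ) A g) := by
    rw [hp]
    have hnn : ∀ i ∈ Finset.univ, 0 ≤ l i * inner ℝ (v i) g ^ 2 := fun i _ =>
      mul_nonneg (hl i).le (sq_nonneg _)
    refine mul_pos (by positivity) ((Finset.sum_nonneg hnn).lt_of_ne' fun h0 => hg ?_)
    rw [Finset.sum_eq_zero_iff_of_nonneg hnn] at h0
    rw [← norm_eq_zero, ← sq_eq_zero_iff, ← v.sum_sq_inner_right]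
    exact Finset.sum_eq_zero fun i hi => (mul_eq_zero.1 (h0 i hi)).resolve_left (hl i).ne'
  obtain ⟨h1, h2⟩ := tls_root_spec (D := ‖t • g‖ ^ 2 - ‖t • Matrix.toEuclideanCLM (𝕜 := ℝ) A g‖ ^ 2 / γ ^ 2)
    hγ hppos
  change α = _ / _ at hα
  rw [← hα] at h1 h2
  refine ⟨h1, ?_⟩
  rw [hs, hy, hp] at h2
  have h3 : t ^ 2 * ∑ i, inner ℝ (v i) g ^ 2 * ((l i * α - 1) * (α + l i / γ ^ 2)) = 0 := by
    rw [← h2]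
    have : ∀ i, inner ℝ (v i) g ^ 2 * ((l i * α - 1) * (α + l i / γ ^ 2))
        = (l i * inner ℝ (v i) g ^ 2) * α ^ 2 - inner ℝ (v i) g ^ 2 * α
          + (l i ^ 2 * inner ℝ (v i) g ^ 2) * (α / γ ^ 2)
          - (l i * inner ℝ (v i) g ^ 2) * (1 / γ ^ 2) := fun i => by ring
    simp only [this, Finset.sum_sub_distrib, Finset.sum_add_distrib, ← Finset.sum_mul]
    ring
  exact (mul_eq_zero.1 h3).resolve_left (by positivity)

namespace IsBBRun

variable {n : ℕ} {A : Matrix (Fin n) (Fin n) ℝ} {b : EuclideanSpace ℝ (Fin n)} {γ : ℝ}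
  {x : ℕ → EuclideanSpace ℝ (Fin n)} {α : ℕ → ℝ}

theorem inner_gradient_succ (h : IsBBRun (quadraticFun A b) γ x α) (hA : A.IsHermitian)
    {v : EuclideanSpace ℝ (Fin n)} {l : ℝ} (hv : A.mulVec v.ofLp = l • v.ofLp) {k : ℕ}
    (hk : 1 ≤ k) : inner ℝ v (gradient (quadraticFun A b) (x (k + 1)))
      = (1 - α k * l) * inner ℝ v (gradient (quadraticFun A b) (x k)) := by
  rw [h.step k hk, gradient_quadraticFun_sub_smul hA, inner_sub_right, real_inner_smul_right,
    inner_toEuclideanCLM_of_mulVec_eq hA hv]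
  ring

theorem gradient_ne_zero_of_succ (h : IsBBRun (quadraticFun A b) γ x α) {k : ℕ} (hk : 1 ≤ k)
    (hg : gradient (quadraticFun A b) (x (k + 1)) ≠ 0) :
    gradient (quadraticFun A b) (x k) ≠ 0 := fun h0 => hg <| by
  rw [h.step k hk, h0, smul_zero, sub_zero, h0]

theorem steplength_succ_spec {ι : Type*} [Fintype ι] (h : IsBBRun (quadraticFun A b) γ x α)
    (hA : A.IsHermitian) (v : OrthonormalBasis ι ℝ (EuclideanSpace ℝ (Fin n))) {l : ι → ℝ}
    (hv : ∀ i, A.mulVec (v i).ofLp = l i • (v i).ofLp) (hl : ∀ i, 0 < l i) (hγ : 0 < γ) {k : ℕ}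
    (hk : 1 ≤ k) (hg : gradient (quadraticFun A b) (x (k + 1)) ≠ 0) :
    0 < α (k + 1) ∧ ∑ i, inner ℝ (v i) (gradient (quadraticFun A b) (x k)) ^ 2 *
      ((l i * α (k + 1) - 1) * (α (k + 1) + l i / γ ^ 2)) = 0 := by
  have key : ∀ j, 1 ≤ j → α j ≠ 0 → gradient (quadraticFun A b) (x (j + 1)) ≠ 0 →
      0 < α (j + 1) ∧ ∑ i, inner ℝ (v i) (gradient (quadraticFun A b) (x j)) ^ 2 *
        ((l i * α (j + 1) - 1) * (α (j + 1) + l i / γ ^ 2)) = 0 := by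
    intro j hj hαj hgj
    refine bbSteplength_spec hA v hv hl hγ (neg_ne_zero.2 hαj)
      (h.gradient_ne_zero_of_succ hj hgj) ?_
    rw [h.steplength (j + 1) (by omega) hgj, Nat.add_sub_cancel]
    congr 1
    · rw [h.step j hj]; simp
    · rw [h.step j hj, gradient_quadraticFun_sub_smul hA]; simp
  -- A nonzero steplength makes the next `s` nonzero, hence the next steplength positive; the chain
  -- starts from the arbitrary `α 1 ≠ 0`.
  have hne : ∀ j, 1 ≤ j → gradient (quadraticFun A b) (x j) ≠ 0 → α j ≠ 0 := by
    intro j hj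
    induction j, hj using Nat.le_induction with
    | base => exact fun _ => h.first
    | succ j hj ih =>
      intro hgj
      exact (key j hj (ih (h.gradient_ne_zero_of_succ hj hgj)) hgj).1.ne'
  exact key k hk (hne k hk (h.gradient_ne_zero_of_succ hk hg)) hg

end IsBBRun

/-! ### R-linear convergence -/

section SecularStep

variable {ι : Type*} [Fintype ι] {w l : ι → ℝ} {α κ : ℝ}

/-- Otherwise every factor `l i * α - 1` is negative and the sum can vanish only if all weights do.
The upper bound on `α` is the mirror image. -/
theorem one_le_mul_of_secular (hw : ∀ i, 0 ≤ w i) (hw0 : ∑ i, w i ≠ 0) (hl : ∀ i, 0 < l i)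
    (hκ : 0 ≤ κ) (hα : 0 < α) (h : ∑ i, w i * ((l i * α - 1) * (α + l i * κ)) = 0) {L : ℝ}
    (hL : ∀ i, l i ≤ L) : 1 ≤ L * α := by
  by_contra! hlt
  have hneg : ∀ i, (l i * α - 1) * (α + l i * κ) < 0 := fun i =>
    mul_neg_of_neg_of_pos (by nlinarith [hL i]) (by nlinarith [mul_nonneg (hl i).le hκ])
  rw [Finset.sum_eq_zero_iff_of_nonpos fun i _ =>
    mul_nonpos_of_nonneg_of_nonpos (hw i) (hneg i).le] at h
  exact hw0 (Finset.sum_eq_zero fun i hi => (mul_eq_zero.1 (h i hi)).resolve_right (hneg i).ne)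

theorem mul_le_one_of_secular (hw : ∀ i, 0 ≤ w i) (hw0 : ∑ i, w i ≠ 0) (hl : ∀ i, 0 < l i)
    (hκ : 0 ≤ κ) (hα : 0 < α) (h : ∑ i, w i * ((l i * α - 1) * (α + l i * κ)) = 0) {m : ℝ}
    (hm : ∀ i, m ≤ l i) : m * α ≤ 1 := by
  by_contra! hlt
  have hpos : ∀ i, 0 < (l i * α - 1) * (α + l i * κ) := fun i =>
    mul_pos (by nlinarith [hm i]) (by nlinarith [mul_nonneg (hl i).le hκ])
  rw [Finset.sum_eq_zero_iff_of_nonneg fun i _ => mul_nonneg (hw i) (hpos i).le] at h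
  exact hw0 (Finset.sum_eq_zero fun i hi => (mul_eq_zero.1 (h i hi)).resolve_right (hpos i).ne')

/-- If the steplength is too long for the eigenvalue `l i`, then the corresponding weight is
controlled by the weights of the smaller eigenvalues. -/
theorem le_two_mul_sum_of_secular (hw : ∀ i, 0 ≤ w i) (hl : ∀ i, 0 < l i) (hκ : 0 ≤ κ)
    (hα : 0 < α) (h : ∑ i, w i * ((l i * α - 1) * (α + l i * κ)) = 0) {i : ι}
    (hi : 3 / 2 < l i * α) : w i ≤ 2 * ∑ j with l j < l i, w j := by
  have hpos : ∀ j, 0 < α + l j * κ := fun j => by nlinarith [mul_nonneg (hl j).le hκ]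
  rw [← Finset.sum_filter_add_sum_filter_not Finset.univ (fun j => l j < l i)] at h
  -- Smaller eigenvalues contribute at least `-w j * (α + l i * κ)` each, because `l j * α - 1 >
  -- -1`. The remaining terms are nonnegative, and index `i` alone gives at least half of `w i * (α
  -- + l i * κ)`.
  have h1 : -((∑ j with l j < l i, w j) * (α + l i * κ))
      ≤ ∑ j with l j < l i, w j * ((l j * α - 1) * (α + l j * κ)) := by
    rw [Finset.sum_mul, ← Finset.sum_neg_distrib]
    refine Finset.sum_le_sum fun j hj => ?_
    have hj' : l j < l i := (Finset.mem_filter.1 hj).2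
    have : α + l j * κ ≤ α + l i * κ := by gcongr
    have h2 : -(α + l i * κ) ≤ (l j * α - 1) * (α + l j * κ) := by
      nlinarith [mul_pos (mul_pos (hl j) hα) (hpos j)]
    calc -(w j * (α + l i * κ)) = w j * (-(α + l i * κ)) := by ring
      _ ≤ _ := mul_le_mul_of_nonneg_left h2 (hw j)
  have h2 : w i * (1 / 2 * (α + l i * κ))
      ≤ ∑ j with ¬ l j < l i, w j * ((l j * α - 1) * (α + l j * κ)) := by
    have hnn : ∀ j ∈ Finset.univ.filter (fun j => ¬ l j < l i),
        0 ≤ w j * ((l j * α - 1) * (α + l j * κ)) := fun j hj => by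
      have hj' : l i ≤ l j := not_lt.1 (Finset.mem_filter.1 hj).2
      exact mul_nonneg (hw j) (mul_nonneg (by nlinarith) (hpos j).le)
    refine le_trans ?_ (Finset.single_le_sum hnn
      (Finset.mem_filter.2 ⟨Finset.mem_univ i, lt_irrefl _⟩))
    refine mul_le_mul_of_nonneg_left (mul_le_mul_of_nonneg_right ?_ (hpos i).le) (hw i)
    linarith
  have h3 : w i * (α + l i * κ) ≤ (2 * ∑ j with l j < l i, w j) * (α + l i * κ) := by linarith
  exact le_of_mul_le_mul_right h3 (hpos i)

end SecularStep

theorem convergesRLinearly_of_secular {ι : Type*} [Fintype ι] {w : ℕ → ι → ℝ} {l : ι → ℝ}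
    {α : ℕ → ℝ} {κ : ℝ} (hl : ∀ i, 0 < l i) (hκ : 0 ≤ κ) (hw : ∀ k i, 0 ≤ w k i)
    (hw0 : ∀ k, 1 ≤ k → ∑ i, w k i ≠ 0) (hα : ∀ k, 1 ≤ k → 0 < α (k + 1))
    (hstep : ∀ k, 1 ≤ k → ∀ i, w (k + 1) i = (1 - α k * l i) ^ 2 * w k i)
    (hsec : ∀ k, 1 ≤ k →
      ∑ i, w k i * ((l i * α (k + 1) - 1) * (α (k + 1) + l i * κ)) = 0) :
    ConvergesRLinearly fun k => ∑ i, w k i := by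
  rcases isEmpty_or_nonempty ι with hι | hι
  · exact absurd (by simp) (hw0 1 le_rfl)
  obtain ⟨i₁, hi₁⟩ := Finite.exists_max l
  obtain ⟨i₀, hi₀⟩ := Finite.exists_min l
  set L := l i₁
  set m := l i₀
  have hL : 0 < L := hl _
  have hm : 0 < m := hl _
  have hup : ∀ k, 1 ≤ k → m * α (k + 1) ≤ 1 := fun k hk =>
    mul_le_one_of_secular (hw k) (hw0 k hk) hl hκ (hα k hk) (hsec k hk) hi₀
  have hlow : ∀ k, 1 ≤ k → 1 ≤ L * α (k + 1) := fun k hk =>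
    one_le_mul_of_secular (hw k) (hw0 k hk) hl hκ (hα k hk) (hsec k hk) hi₁
  have hmul : ∀ k, 1 ≤ k → ∀ i, m / L ≤ α (k + 1) * l i ∧ α (k + 1) * l i ≤ L / m := by
    intro k hk i
    rw [div_le_iff₀ hL, le_div_iff₀ hm]
    constructor
    · nlinarith [hup k hk, hlow k hk, hi₀ i, mul_le_mul (hi₀ i) (hlow k hk) zero_le_one (hl i).le]
    · nlinarith [mul_le_mul (hi₁ i) (hup k hk) (mul_pos hm (hα k hk)).le hL.le]
  have hmL : 0 < m / L := by positivity
  have hmL1 : m / L ≤ 1 := (div_le_one hL).2 (hi₀ _)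
  set K := (1 + L / m) ^ 2
  -- The bound starts at `k = 2` because `α 1` is arbitrary.
  have hgrow : ∀ k, 2 ≤ k → ∀ i, w (k + 1) i ≤ K * w k i := by
    intro k hk i
    obtain ⟨k, rfl⟩ : ∃ j, k = j + 1 := ⟨k - 1, by omega⟩
    have hb := hmul k (by omega) i
    rw [hstep _ (by omega)]
    refine mul_le_mul_of_nonneg_right (sq_le_sq' ?_ ?_) (hw _ _) <;> linarith
  -- The two entries bound `(1 - α lᵢ) ^ 2` for `1 ≤ α lᵢ ≤ 3/2` and for `m / L ≤ α lᵢ ≤ 1`.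
  set ρ := max (1 / 4) ((1 - m / L) ^ 2)
  have hρ0 : 0 < ρ := lt_max_of_lt_left (by norm_num)
  have hρ1 : ρ < 1 := max_lt (by norm_num) (by nlinarith)
  have hcomp : ∀ i, ConvergesRLinearly fun k => w k i := by
    intro i
    have : IsTrans ι fun i j => l i < l j := ⟨fun _ _ _ => lt_trans⟩
    have : Std.Irrefl fun i j : ι => l i < l j := ⟨fun i => lt_irrefl (l i)⟩
    induction i using (Finite.wellFounded_of_trans_of_irrefl fun i j => l i < l j).induction with
    | _ i ih =>
      -- The steplength `α (k + 1)` is governed by the weights at `k` but acts on those at `k + 1`.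
      -- Two growth steps carry the bound from `w k i` to `w (k + 2) i`, whence `K * K * 2` and the
      -- index shift.
      have hu := (ConvergesRLinearly.sum (Finset.univ.filter fun j => l j < l i) fun j hj =>
        ih j (Finset.mem_filter.1 hj).2).const_mul (by positivity : 0 ≤ K * K * 2)
      refine (hu.of_contract_or_le hρ0 hρ1 2 fun k hk => ?_ :
        ConvergesRLinearly fun k => w (k + 1) i).of_succ
      rcases le_or_gt (l i * α (k + 1)) (3 / 2) with hle | hgt
      · left
        rw [hstep (k + 1) (by omega)]
        refine mul_le_mul_of_nonneg_right ?_ (hw _ _)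
        have hb := (hmul k (by omega) i).1
        rcases le_total (α (k + 1) * l i) 1 with h1 | h1
        · exact le_max_of_le_right (sq_le_sq' (by linarith) (by linarith))
        · exact le_max_of_le_left (by nlinarith)
      · right
        have h1 := le_two_mul_sum_of_secular (hw k) hl hκ (hα k (by omega)) (hsec k (by omega)) hgt
        calc w (k + 1 + 1) i ≤ K * (K * w k i) :=
              (hgrow _ (by omega) i).trans (mul_le_mul_of_nonneg_left (hgrow k hk i) (by positivity))
          _ ≤ K * (K * (2 * ∑ j with l j < l i, w k j)) := by gcongr
          _ = _ := by ring
  exact ConvergesRLinearly.sum _ fun i _ => hcomp i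

theorem IsBBRun.convergesRLinearly {n : ℕ} {A : Matrix (Fin n) (Fin n) ℝ}
    {b : EuclideanSpace ℝ (Fin n)} {γ : ℝ} {x : ℕ → EuclideanSpace ℝ (Fin n)} {α : ℕ → ℝ}
    (h : IsBBRun (quadraticFun A b) γ x α) (hA : A.PosDef) (hγ : 0 < γ)
    (hg : ∀ k, 1 ≤ k → gradient (quadraticFun A b) (x k) ≠ 0) :
    ConvergesRLinearly fun k => ‖gradient (quadraticFun A b) (x k)‖ := by
  have hH := hA.isHermitian
  have hv := hH.mulVec_eigenvectorBasis
  have hs := fun k hk => h.steplength_succ_spec hH hH.eigenvectorBasis hv hA.eigenvalues_pos hγ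
    (k := k) hk (hg _ (by omega))
  refine ConvergesRLinearly.of_sq ?_
  simp only [← hH.eigenvectorBasis.sum_sq_inner_right]
  refine convergesRLinearly_of_secular (α := α) (κ := 1 / γ ^ 2) hA.eigenvalues_pos
    (by positivity) (fun k i => sq_nonneg _) (fun k hk => ?_) (fun k hk => (hs k hk).1)
    (fun k hk i => ?_) (fun k hk => ?_)
  · rw [hH.eigenvectorBasis.sum_sq_inner_right]
    simpa using hg k hk
  · rw [h.inner_gradient_succ hH (hv i) hk, mul_pow]
  · simpa only [div_eq_mul_one_div (hA.1.eigenvalues _)] using (hs k hk).2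

/-! ### R-superlinear convergence in two dimensions -/

/-- With both weights positive the two terms must have strictly opposite signs. This strictness
keeps both gradient components nonzero forever. -/
theorem secular_two_bounds {W₁ W₂ l₁ l₂ α κ : ℝ} (hW₁ : 0 < W₁) (hW₂ : 0 < W₂) (hl₁ : 0 < l₁)
    (hl : l₁ < l₂) (hκ : 0 ≤ κ) (hα : 0 < α)
    (h : W₁ * ((l₁ * α - 1) * (α + l₁ * κ)) + W₂ * ((l₂ * α - 1) * (α + l₂ * κ)) = 0) :
    l₁ * α < 1 ∧ 1 < l₂ * α := by
  have hp₁ : 0 < W₁ * (α + l₁ * κ) := by positivity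
  have hp₂ : 0 < W₂ * (α + l₂ * κ) := by have := hl₁.trans hl; positivity
  have hlt : l₁ * α < l₂ * α := mul_lt_mul_of_pos_right hl hα
  constructor
  · by_contra! hc
    nlinarith [mul_nonneg hp₁.le (sub_nonneg.2 hc), mul_pos hp₂ (by linarith : 0 < l₂ * α - 1)]
  · by_contra! hc
    nlinarith [mul_nonneg hp₂.le (sub_nonneg.2 hc), mul_pos hp₁ (by linarith : 0 < 1 - l₁ * α)]

/-- The witness `τ = (α + l₁ κ) / (α + l₂ κ)` carries all the dependence on `γ`; its bounds do not
involve `γ`, so neither does the size of the perturbation `-2 log τ`. -/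
theorem secular_two_ratio {W₁ W₂ l₁ l₂ α κ : ℝ} (hW₂ : 0 < W₂) (hl₁ : 0 < l₁)
    (hl : l₁ < l₂) (hκ : 0 ≤ κ) (hα : 0 < α)
    (h : W₁ * ((l₁ * α - 1) * (α + l₁ * κ)) + W₂ * ((l₂ * α - 1) * (α + l₂ * κ)) = 0) :
    ∃ τ, l₁ / l₂ ≤ τ ∧ τ ≤ 1 ∧ l₂ * α - 1 = W₁ / W₂ * τ * (1 - l₁ * α) := by
  have hl₂ := hl₁.trans hl
  have hp₂ : 0 < α + l₂ * κ := by positivity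
  refine ⟨(α + l₁ * κ) / (α + l₂ * κ), ?_, ?_, ?_⟩
  · rw [div_le_div_iff₀ hl₂ hp₂]
    nlinarith
  · rw [div_le_one hp₂]
    nlinarith
  · field_simp
    linarith

theorem exists_le_mul_pow_of_secular_two {p q α : ℕ → ℝ} {l₁ l₂ κ : ℝ} {θ : ℂ} (hl₁ : 0 < l₁)
    (hl : l₁ < l₂) (hκ : 0 ≤ κ) (hθ : θ ^ 2 = θ - 2) (hnorm : ‖θ‖ = √2)
    (hp : ∀ k, 1 ≤ k → p (k + 1) = (1 - α k * l₁) * p k)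
    (hq : ∀ k, 1 ≤ k → q (k + 1) = (1 - α k * l₂) * q k)
    (hsec : ∀ k, 1 ≤ k → p (k + 1) ≠ 0 → 0 < α (k + 1) ∧
      p k ^ 2 * ((l₁ * α (k + 1) - 1) * (α (k + 1) + l₁ * κ)) +
        q k ^ 2 * ((l₂ * α (k + 1) - 1) * (α (k + 1) + l₂ * κ)) = 0)
    (hp₁ : p 1 ≠ 0) (hq₁ : q 1 ≠ 0) (hp₂ : p 2 ≠ 0) (hq₂ : q 2 ≠ 0)
    (hξ : 8 * Real.log (l₂ / l₁) ≤ ‖(Real.log ((p 2 / q 2) ^ 2) : ℂ) +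
      (θ - 1) * (Real.log ((p 1 / q 1) ^ 2) : ℂ)‖) {r : ℝ} (hr : 0 < r) :
    ∃ C, ∀ k, p (k + 1) ^ 2 + q (k + 1) ^ 2 ≤ C * r ^ k := by
  have hl₂ := hl₁.trans hl
  have hne : ∀ k, 1 ≤ k → (p k ≠ 0 ∧ q k ≠ 0) ∧ p (k + 1) ≠ 0 ∧ q (k + 1) ≠ 0 := by
    intro k hk
    induction k, hk using Nat.le_induction with
    | base => exact ⟨⟨hp₁, hq₁⟩, hp₂, hq₂⟩
    | succ k hk ih =>
      obtain ⟨⟨h1, h2⟩, h3, h4⟩ := ih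
      obtain ⟨hα, hs⟩ := hsec k hk h3
      obtain ⟨b1, b2⟩ := secular_two_bounds (by positivity) (by positivity) hl₁ hl hκ hα hs
      refine ⟨⟨h3, h4⟩, ?_, ?_⟩
      · rw [hp _ (by omega)]
        exact mul_ne_zero (by linarith) h3
      · rw [hq _ (by omega)]
        exact mul_ne_zero (by linarith) h4
  set Λ := l₂ / l₁ with hΛ
  have hΛ1 : 1 < Λ := (one_lt_div hl₁).2 hl
  have hstep : ∀ k, ∃ τ, 1 / Λ ≤ τ ∧ τ ≤ 1 ∧ 0 < α (k + 2) ∧ l₁ * α (k + 2) < 1 ∧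
      1 < l₂ * α (k + 2) ∧
      l₂ * α (k + 2) - 1 = (p (k + 1) / q (k + 1)) ^ 2 * τ * (1 - l₁ * α (k + 2)) := by
    intro k
    obtain ⟨⟨h1, h2⟩, h3, h4⟩ := hne (k + 1) (by omega)
    obtain ⟨hα, hs⟩ := hsec (k + 1) (by omega) h3
    obtain ⟨b1, b2⟩ := secular_two_bounds (by positivity) (by positivity) hl₁ hl hκ hα hs
    obtain ⟨τ, t1, t2, t3⟩ := secular_two_ratio (by positivity) hl₁ hl hκ hα hs
    refine ⟨τ, by rwa [hΛ, one_div_div], t2, hα, b1, b2, ?_⟩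
    rw [div_pow]
    exact t3
  choose τ hτ₁ hτ₂ hα hb₁ hb₂ hτ using hstep
  have hτ0 : ∀ k, 0 < τ k := fun k => lt_of_lt_of_le (by positivity) (hτ₁ k)
  -- Indices are shifted by one: `M 0` and `M 1` belong to the gradients at `x 1` and `x 2`.
  set M : ℕ → ℝ := fun k => Real.log ((p (k + 1) / q (k + 1)) ^ 2) with hM
  have hpq : ∀ k, 0 < (p (k + 1) / q (k + 1)) ^ 2 := fun k => by
    obtain ⟨⟨h1, h2⟩, -⟩ := hne (k + 1) (by omega)
    positivity
  have hexp : ∀ k, Real.exp (M k) = (p (k + 1) / q (k + 1)) ^ 2 := fun k => Real.exp_log (hpq k)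
  have hrec : ∀ k, M (k + 2) = M (k + 1) - 2 * M k + -2 * Real.log (τ k) := by
    intro k
    have hz : 0 < 1 - l₁ * α (k + 2) := by linarith [hb₁ k]
    have hprod : (p (k + 2 + 1) / q (k + 2 + 1)) ^ 2 * ((p (k + 1) / q (k + 1)) ^ 2 * τ k) ^ 2
        = (p (k + 1 + 1) / q (k + 1 + 1)) ^ 2 := by
      have h4 : q (k + 2) ≠ 0 := (hne (k + 1) (by omega)).2.2
      rw [hp (k + 2) (by omega), hq (k + 2) (by omega), ← mul_pow]
      have : (p (k + 1) / q (k + 1)) ^ 2 * τ k = (l₂ * α (k + 2) - 1) / (1 - l₁ * α (k + 2)) := by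
        rw [eq_div_iff hz.ne', hτ k]
      rw [this, mul_div_mul_comm, show 1 - α (k + 2) * l₁ = 1 - l₁ * α (k + 2) by ring,
        show 1 - α (k + 2) * l₂ = -(l₂ * α (k + 2) - 1) by ring]
      have hy' : l₂ * α (k + 2) - 1 ≠ 0 := by linarith [hb₂ k]
      generalize l₂ * α (k + 2) - 1 = y at hy' ⊢
      field_simp
    have hlog := congrArg Real.log hprod
    rw [Real.log_mul (hpq (k + 2)).ne' (by have := hpq k; have := hτ0 k; positivity),
      Real.log_pow (_ * τ k),
      Real.log_mul (hpq k).ne' (hτ0 k).ne'] at hlog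
    simp only [hM]
    push_cast at hlog
    linarith
  -- With `E = 2 log Λ` the divergence threshold `4 E` is exactly `8 log Λ`.
  have hE : 0 < 2 * Real.log Λ := by have := Real.log_pos hΛ1; positivity
  have he : ∀ k, |-2 * Real.log (τ k)| ≤ 2 * Real.log Λ := by
    intro k
    have h1 := Real.log_nonpos (hτ0 k).le (hτ₂ k)
    have h2 := Real.log_le_log (by positivity) (hτ₁ k)
    rw [one_div, Real.log_inv] at h2
    exact abs_le.2 ⟨by linarith, by linarith⟩
  have hlim := tendsto_norm_add_mul_atTop hE hrec he hθ hnorm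
    (by rw [show 4 * (2 * Real.log Λ) = 8 * Real.log Λ by ring]; exact hξ)
  have hΛα : ∀ k, l₂ * α (k + 2) - 1 ≤ Λ := by
    intro k
    have : l₂ * α (k + 2) ≤ Λ := by
      rw [hΛ, le_div_iff₀ hl₁]
      nlinarith [hb₁ k]
    linarith
  have hK : 1 ≤ Λ ^ 2 := one_le_pow₀ hΛ1.le
  have hP := fun (ε : ℝ) (hε : 0 < ε) => eventually_le_of_window (u := fun k => p (k + 1) ^ 2) (N := M)
    (K := Λ ^ 2) (fun k => sq_nonneg _) hK
    (fun k hk => by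
      obtain ⟨k, rfl⟩ : ∃ j, k = j + 1 := ⟨k - 1, by omega⟩
      rw [hp (k + 1 + 1) (by omega), mul_pow]
      refine mul_le_mul_of_nonneg_right (le_trans ?_ hK) (sq_nonneg _)
      have := mul_pos hl₁ (hα k)
      have := hb₁ k
      nlinarith)
    (fun k => by
      rw [hp (k + 2) (by omega), mul_pow]
      refine mul_le_mul_of_nonneg_right ?_ (sq_nonneg _)
      have h1 := mul_pos hl₁ (hα k)
      have h2 := hb₁ k
      -- One `Λ` bounds `l₂ α - 1`, the other bounds `1 / τ`. Only one of the two factors of `(1 -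
      -- l₁ α) ^ 2` is needed; the other is at most 1.
      have h3 : Real.exp (M k) * (1 - l₁ * α (k + 2)) ≤ Λ ^ 2 := by
        have h4 : Real.exp (M k) * τ k * (1 - l₁ * α (k + 2)) ≤ Λ := by
          rw [hexp, ← hτ k]; exact hΛα k
        have h5 : 1 ≤ Λ * τ k := by
          have := hτ₁ k
          rwa [div_le_iff₀' (by positivity)] at this
        have h6 : 0 ≤ Real.exp (M k) * (1 - l₁ * α (k + 2)) :=
          mul_nonneg (Real.exp_pos _).le (by linarith)
        nlinarith
      have h7 : 1 - l₁ * α (k + 2) ≤ Λ ^ 2 * Real.exp (-M k) := by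
        rw [Real.exp_neg, ← div_eq_mul_inv, le_div_iff₀' (Real.exp_pos _)]
        exact h3
      nlinarith)
    (exists_window_ge hrec he hnorm hlim) hε
  have hQ := fun (ε : ℝ) (hε : 0 < ε) => eventually_le_of_window (u := fun k => q (k + 1) ^ 2)
    (N := fun k => -M k) (K := Λ ^ 2) (fun k => sq_nonneg _) hK
    (fun k hk => by
      obtain ⟨k, rfl⟩ : ∃ j, k = j + 1 := ⟨k - 1, by omega⟩
      rw [hq (k + 1 + 1) (by omega), mul_pow]
      refine mul_le_mul_of_nonneg_right ?_ (sq_nonneg _)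
      have := hb₂ k
      have := hΛα k
      exact sq_le_sq' (by linarith) (by linarith))
    (fun k => by
      rw [hq (k + 2) (by omega), mul_pow]
      refine mul_le_mul_of_nonneg_right ?_ (sq_nonneg _)
      have h1 := mul_pos hl₁ (hα k)
      have h2 := hb₁ k
      have h3 := hb₂ k
      have h4 := hΛα k
      -- One factor of `(l₂ α - 1) ^ 2` is bounded by `exp (M k)`, the other by `Λ`.
      have h5 : l₂ * α (k + 2) - 1 ≤ Real.exp (M k) := by
        rw [hτ k, ← hexp, mul_assoc]
        refine mul_le_of_le_one_right (Real.exp_pos _).le ?_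
        have := hτ₂ k
        have := hτ0 k
        nlinarith
      rw [neg_neg]
      have h6 : Λ ≤ Λ ^ 2 := by nlinarith
      calc (1 - α (k + 2) * l₂) ^ 2 = (l₂ * α (k + 2) - 1) * (l₂ * α (k + 2) - 1) := by ring
        _ ≤ Λ ^ 2 * Real.exp (M k) :=
          mul_le_mul (h4.trans h6) h5 (by linarith) (by positivity))
    (fun B => (exists_window_le hrec he hnorm hlim B).mono fun k ⟨j, hj, hB⟩ =>
      ⟨j, hj, by linarith⟩) hε
  obtain ⟨C, hC⟩ := exists_le_mul_pow_of_eventually_le (u := fun k => p (k + 1) ^ 2) (m := 6)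
    (by norm_num) hP hr
  obtain ⟨D, hD⟩ := exists_le_mul_pow_of_eventually_le (u := fun k => q (k + 1) ^ 2) (m := 6)
    (by norm_num) hQ hr
  exact ⟨C + D, fun k => by rw [add_mul]; exact add_le_add (hC k) (hD k)⟩

theorem sq_eq_sub_two_of_eq {θ : ℂ} (hθ : θ = (1 + (Real.sqrt 7 : ℂ) * Complex.I) / 2 ∨
    θ = (1 - (Real.sqrt 7 : ℂ) * Complex.I) / 2) : θ ^ 2 = θ - 2 := by
  have h7 : (Real.sqrt 7 : ℂ) ^ 2 = 7 := by
    rw [← Complex.ofReal_pow, Real.sq_sqrt (by norm_num)]; norm_num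
  rcases hθ with rfl | rfl <;>
    linear_combination (1 / 4 : ℂ) * (Real.sqrt 7 : ℂ) ^ 2 * Complex.I_sq - (1 / 4 : ℂ) * h7

theorem norm_eq_sqrt_two_of_eq {θ : ℂ} (hθ : θ = (1 + (Real.sqrt 7 : ℂ) * Complex.I) / 2 ∨
    θ = (1 - (Real.sqrt 7 : ℂ) * Complex.I) / 2) : ‖θ‖ = √2 := by
  have h7 : √7 ^ 2 = 7 := Real.sq_sqrt (by norm_num)
  rw [Complex.norm_def]
  congr 1
  rcases hθ with rfl | rfl <;> simp [Complex.normSq_apply] <;> linarith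

theorem inner_eq_zero_of_mulVec_eq {n : ℕ} {A : Matrix (Fin n) (Fin n) ℝ} (hA : A.IsHermitian)
    {u v : EuclideanSpace ℝ (Fin n)} {l m : ℝ} (hlm : l ≠ m) (hu : A.mulVec u.ofLp = l • u.ofLp)
    (hv : A.mulVec v.ofLp = m • v.ofLp) : inner ℝ u v = 0 := by
  have h1 := inner_toEuclideanCLM_of_mulVec_eq hA hu v
  rw [← inner_toEuclideanCLM_comm hA, real_inner_comm, inner_toEuclideanCLM_of_mulVec_eq hA hv,
    real_inner_comm] at h1
  have h2 : (m - l) * inner ℝ u v = 0 := by linarith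
  exact (mul_eq_zero.1 h2).resolve_left (sub_ne_zero.2 hlm.symm)

theorem pos_of_mulVec_eq {n : ℕ} {A : Matrix (Fin n) (Fin n) ℝ} (hA : A.PosDef)
    {u : EuclideanSpace ℝ (Fin n)} {l : ℝ} (hu : A.mulVec u.ofLp = l • u.ofLp) (hu0 : u ≠ 0) :
    0 < l := by
  have h := hA.dotProduct_mulVec_pos (x := u.ofLp) (by simpa using hu0)
  rw [hu, dotProduct_smul, smul_eq_mul] at h
  exact pos_of_mul_pos_left h (by simpa using dotProduct_star_self_nonneg u.ofLp)

theorem IsBBRun.convergesRSuperlinearly {A : Matrix (Fin 2) (Fin 2) ℝ}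
    {b : EuclideanSpace ℝ (Fin 2)} {γ : ℝ} {x : ℕ → EuclideanSpace ℝ (Fin 2)} {α : ℕ → ℝ}
    {μ₁ μ₂ : ℝ} {u₁ u₂ : EuclideanSpace ℝ (Fin 2)} {θ : ℂ} (hγ : 0 < γ) (hA : A.PosDef)
    (h : IsBBRun (quadraticFun A b) γ x α) (hμ : μ₁ < μ₂) (hu₁ : ‖u₁‖ = 1) (hu₂ : ‖u₂‖ = 1)
    (hv₁ : A.mulVec u₁.ofLp = μ₁ • u₁.ofLp) (hv₂ : A.mulVec u₂.ofLp = μ₂ • u₂.ofLp)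
    (hθ : θ ^ 2 = θ - 2) (hnorm : ‖θ‖ = √2)
    (hne : ∀ j : ℕ, j = 1 ∨ j = 2 → inner ℝ u₁ (gradient (quadraticFun A b) (x j)) ≠ 0 ∧
      inner ℝ u₂ (gradient (quadraticFun A b) (x j)) ≠ 0)
    (hξ : 8 * Real.log (μ₂ / μ₁) ≤ ‖(logRatio u₁ u₂ (gradient (quadraticFun A b) (x 2)) : ℂ) +
      (θ - 1) * (logRatio u₁ u₂ (gradient (quadraticFun A b) (x 1)) : ℂ)‖) :
    ConvergesRSuperlinearly fun k => ‖gradient (quadraticFun A b) (x k)‖ := by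
  have hH := hA.isHermitian
  have horth := inner_eq_zero_of_mulVec_eq hH hμ.ne hv₁ hv₂
  have hon : Orthonormal ℝ ![u₁, u₂] := by
    rw [orthonormal_iff_ite]
    intro i j
    fin_cases i <;> fin_cases j <;> simp [hu₁, hu₂, horth, real_inner_comm u₁ u₂]
  let v : OrthonormalBasis (Fin 2) ℝ (EuclideanSpace ℝ (Fin 2)) := OrthonormalBasis.mk hon
    (hon.linearIndependent.span_eq_top_of_card_eq_finrank' (by simp)).ge
  have hv0 : v 0 = u₁ := by simp [v]
  have hv1 : v 1 = u₂ := by simp [v]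
  have hev : ∀ i, A.mulVec (v i).ofLp = ![μ₁, μ₂] i • (v i).ofLp := by
    intro i
    fin_cases i
    · simpa [hv0] using hv₁
    · simpa [hv1] using hv₂
  have hμ₁ : 0 < μ₁ := pos_of_mulVec_eq hA hv₁ (norm_ne_zero_iff.1 (by simp [hu₁]))
  have hpos : ∀ i, 0 < ![μ₁, μ₂] i := by
    intro i
    fin_cases i
    · simpa using hμ₁
    · simpa using hμ₁.trans hμ
  have hsq : ∀ g, ‖g‖ ^ 2 = inner ℝ u₁ g ^ 2 + inner ℝ u₂ g ^ 2 := fun g => by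
    rw [← v.sum_sq_inner_right, Fin.sum_univ_two, hv0, hv1]
  refine convergesRSuperlinearly_of_forall_le (fun k => norm_nonneg _) fun r hr => ?_
  -- Applied with rate `r ^ 2`, since it bounds the squared norm.
  obtain ⟨C, hC⟩ := exists_le_mul_pow_of_secular_two
    (p := fun k => inner ℝ u₁ (gradient (quadraticFun A b) (x k)))
    (q := fun k => inner ℝ u₂ (gradient (quadraticFun A b) (x k))) (α := α) (κ := 1 / γ ^ 2)
    hμ₁ hμ (by positivity) hθ hnorm (fun k hk => h.inner_gradient_succ hH hv₁ hk)
    (fun k hk => h.inner_gradient_succ hH hv₂ hk)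
    (fun k hk hk0 => by
      have := h.steplength_succ_spec hH v hev hpos hγ hk
        (fun h0 => hk0 (by simp [h0]))
      simpa only [Fin.sum_univ_two, hv0, hv1, Matrix.cons_val_zero, Matrix.cons_val_one,
        div_eq_mul_one_div μ₁, div_eq_mul_one_div μ₂] using this)
    (hne 1 (Or.inl rfl)).1 (hne 1 (Or.inl rfl)).2 (hne 2 (Or.inr rfl)).1 (hne 2 (Or.inr rfl)).2
    hξ (pow_pos hr 2)
  simp only [← hsq] at hC
  have hC0 : 0 ≤ C := by simpa using (sq_nonneg _).trans (hC 0)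
  refine ⟨√C / r, fun k hk => ?_⟩
  obtain ⟨j, rfl⟩ : ∃ j, k = j + 1 := ⟨k - 1, by omega⟩
  have hrw : √C / r * r ^ (j + 1) = √C * r ^ j := by rw [pow_succ]; field_simp
  rw [hrw]
  refine le_of_abs_le (abs_le_of_sq_le_sq' ?_ (by positivity) |> abs_le.2)
  rw [mul_pow, Real.sq_sqrt hC0, ← pow_mul, mul_comm j, pow_mul]
  exact hC j

theorem theorem3 (γ : ℝ) (hγ : 0 < γ) :
    (∀ (n : ℕ) (A : Matrix (Fin n) (Fin n) ℝ) (b : EuclideanSpace ℝ (Fin n))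
        (x : ℕ → EuclideanSpace ℝ (Fin n)) (α : ℕ → ℝ),
      A.PosDef → IsBBRun (quadraticFun A b) γ x α →
        ConvergesRLinearly (fun k => ‖gradient (quadraticFun A b) (x k)‖) ∨
          ∃ k, 1 ≤ k ∧ gradient (quadraticFun A b) (x k) = 0) ∧
    (∀ (A : Matrix (Fin 2) (Fin 2) ℝ) (b : EuclideanSpace ℝ (Fin 2))
        (x : ℕ → EuclideanSpace ℝ (Fin 2)) (α : ℕ → ℝ)
        (μ₁ μ₂ : ℝ) (u₁ u₂ : EuclideanSpace ℝ (Fin 2)) (θ : ℂ),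
      A.PosDef → IsBBRun (quadraticFun A b) γ x α →
      -- `u₁`, `u₂` are unit eigenvectors for the eigenvalues `μ₁ < μ₂` of `A`
      μ₁ < μ₂ → ‖u₁‖ = 1 → ‖u₂‖ = 1 →
      A.mulVec u₁.ofLp = μ₁ • u₁.ofLp → A.mulVec u₂.ofLp = μ₂ • u₂.ofLp →
      θ = (1 + (Real.sqrt 7 : ℂ) * Complex.I) / 2 ∨
        θ = (1 - (Real.sqrt 7 : ℂ) * Complex.I) / 2 →
      (∀ j : ℕ, j = 1 ∨ j = 2 →
        inner ℝ u₁ (gradient (quadraticFun A b) (x j)) ≠ 0 ∧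
        inner ℝ u₂ (gradient (quadraticFun A b) (x j)) ≠ 0) →
      8 * Real.log (μ₂ / μ₁) ≤
        ‖(logRatio u₁ u₂ (gradient (quadraticFun A b) (x 2)) : ℂ) +
          (θ - 1) * (logRatio u₁ u₂ (gradient (quadraticFun A b) (x 1)) : ℂ)‖ →
      ConvergesRSuperlinearly (fun k => ‖gradient (quadraticFun A b) (x k)‖)) := by
  refine ⟨fun n A b x α hA h => ?_, fun A b x α μ₁ μ₂ u₁ u₂ θ hA h hμ hu₁ hu₂ hv₁ hv₂ hθ hne hξ =>
    h.convergesRSuperlinearly hγ hA hμ hu₁ hu₂ hv₁ hv₂ (sq_eq_sub_two_of_eq hθ)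
      (norm_eq_sqrt_two_of_eq hθ) hne hξ⟩
  by_cases hg : ∃ k, 1 ≤ k ∧ gradient (quadraticFun A b) (x k) = 0
  · exact Or.inr hg
  · push Not at hg
    exact Or.inl (h.convergesRLinearly hA hγ hg)
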